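/- Let $i\ge 0$ be an integer and let $B(\cdot,\cdot)$ denote Euler's Beta function. Consider the gap-size evolution equation, for widths $x>0$ and times $t>0$, \[ \frac{\partial}{\partial t}n(x,t)=-B(i+2,i+2)\,x^{2i+3}\,n(x,t)+2\int_x^\infty x^{i+1}(y-x)^{i+1}\,n(y,t)\,dy . \] There is a nonnegative function $\phi$ on $(0,\infty)$ with \[ \int_0^\infty\phi(y)\,dy=\int_0^\infty y\,\phi(y)\,dy=1 \] such that the equation has a (classical) similarity solution $n^*$ of the form \[ n^*(x,t)=\frac{N^{*}(t)^2}{V}\,\phi\!\left(\frac{N^*(t)\,x}{V}\right),\qquad x>0,\ t>0, \] where $N^*(t)=\int_0^\infty n^*(x,t)\,dx\in(0,\infty)$ and $V=\int_0^\infty x\,n^*(x,t)\,dx\in(0,\infty)$ is independent of $t$, and such that I. $\phi(y)=O(y^{i+1})$ as $y\to0^+$; II. $\phi(y)=O\bigl(y^{-2}\exp(-c\,y^{2i+3})\bigr)$ as $y\to\infty$, for some constant $c>0$. -/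

import Mathlib

open Set Filter Topology MeasureTheory Asymptotics

namespace GapFragmentation

/-- The loss rate `B(i+2, i+2) x^(2i+3)`, i.e. the rate at which gaps of width `x` fragment;
`ProbabilityTheory.beta` is Euler's Beta function of two real arguments. -/
noncomputable def fragRate (i : ℕ) (x : ℝ) : ℝ :=
  ProbabilityTheory.beta ((i : ℝ) + 2) ((i : ℝ) + 2) * x ^ (2 * i + 3)

/-- The kernel `2 x^(i+1) (y-x)^(i+1)`, for the rate of creation of gaps of width `x` from a parent
gap of width `y > x`. -/
def daughterKernel (i : ℕ) (x y : ℝ) : ℝ :=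
  2 * (x ^ (i + 1) * (y - x) ^ (i + 1))

/-- `n x t` is a classical solution, for all widths `x > 0` and all times `t > 0`, of
`∂n/∂t (x,t) = -B(i+2,i+2) x^(2i+3) n(x,t) + 2 ∫_x^∞ x^(i+1) (y-x)^(i+1) n(y,t) dy`,
the integral being convergent. -/
def IsGapSolution (i : ℕ) (n : ℝ → ℝ → ℝ) : Prop :=
  ∀ t : ℝ, 0 < t → ∀ x : ℝ, 0 < x →
    IntegrableOn (fun y => daughterKernel i x y * n y t) (Ioi x) ∧
    HasDerivAt (fun s => n x s)
      (-(fragRate i x) * n x t + ∫ y in Ioi x, daughterKernel i x y * n y t) t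

/-- A reduced distribution: a nonnegative function on `(0,∞)` whose zeroth and first moments
both exist and equal `1`. -/
structure IsReducedDistribution (φ : ℝ → ℝ) : Prop where
  nonneg : ∀ y : ℝ, 0 < y → 0 ≤ φ y
  integrable_zeroth : IntegrableOn φ (Ioi 0)
  integrable_first : IntegrableOn (fun y => y * φ y) (Ioi 0)
  zeroth_moment : ∫ y in Ioi (0 : ℝ), φ y = 1
  first_moment : ∫ y in Ioi (0 : ℝ), y * φ y = 1

/-- The zeroth moment `N(t) = ∫_0^∞ n(x,t) dx` (the number of gaps). -/
noncomputable def zerothMoment (n : ℝ → ℝ → ℝ) (t : ℝ) : ℝ :=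
  ∫ x in Ioi (0 : ℝ), n x t

/-- The first moment `∫_0^∞ x n(x,t) dx` (the total length of the gaps). -/
noncomputable def firstMoment (n : ℝ → ℝ → ℝ) (t : ℝ) : ℝ :=
  ∫ x in Ioi (0 : ℝ), x * n x t

/-- `n` has the similarity form `n(x,t) = (N(t)^2 / V) φ(N(t) x / V)`, where `N(t)` is the zeroth
moment of `n`, and `V` is its first moment, which does not depend on `t`; both moments are
finite and positive. -/
def HasSimilarityForm (φ : ℝ → ℝ) (n : ℝ → ℝ → ℝ) : Prop :=
  ∃ V : ℝ, 0 < V ∧ ∀ t : ℝ, 0 < t →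
    IntegrableOn (fun x => n x t) (Ioi 0) ∧
    IntegrableOn (fun x => x * n x t) (Ioi 0) ∧
    0 < zerothMoment n t ∧
    firstMoment n t = V ∧
    ∀ x : ℝ, 0 < x →
      n x t = zerothMoment n t ^ 2 / V * φ (zerothMoment n t * x / V)

end GapFragmentation

namespace GapFragmentation

/-! Put `b = B(i+2,i+2)` and try `n(x,t) = Q(t)^2 f(Q(t) x)` with `Q^(2i+3) = b t`. The equation
becomes `(y^2 f)' = -(2i+3) y^(2i+4) f + c y^(i+2) ∫_y^∞ (z-y)^(i+1) f(z) dz`, where `c =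
2(2i+3)/b`. Variation of constants, `f = exp(-y^(2i+3)) y^(-2) h`, turns this into `h' = c * gain
h`. With `h(∞) = 1` it is a Volterra equation from infinity, whose kernel is integrable
(`gain_bound`), so a contraction in a weighted sup norm gives a bounded `h`
(`exists_relative_profile`). Boundedness of `h` is the decay at infinity.

Positivity and the behaviour at zero come from conservation of length. Integrating the equation over
`(y,∞)` and exchanging integrals gives `y^2 f(y) = c ∫_y^∞ smallDaughters(y,z) f(z) dz`
(`flux_identity`): length crosses the level `y` only when a larger gap produces a daughter smaller
than `y`. The kernel is positive, so `h` has no last zero; it is at most `y^(i+3) z^(i+1)`, so `f =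
O(y^(i+1))` at zero. Dilating `f` then normalises both moments. -/

/-- The weight `exp (-z^(2i+3)) / z^2` converting the relative profile `h` to the distribution. -/
noncomputable def tailWeight (i : ℕ) (z : ℝ) : ℝ := Real.exp (-z ^ (2 * i + 3)) / z ^ 2

/-- The integral `∫_w^∞ (z-w)^(i+1) φ(z) dz` of the distribution `φ = tailWeight i * h`. -/
noncomputable def tailMoment (i : ℕ) (h : ℝ → ℝ) (w : ℝ) : ℝ :=
  ∫ z in Ioi w, (z - w) ^ (i + 1) * (tailWeight i z * h z)

/-- The gain term of the equation satisfied by the relative profile `h`. -/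
noncomputable def gain (i : ℕ) (h : ℝ → ℝ) (w : ℝ) : ℝ :=
  w ^ (i + 2) * Real.exp (w ^ (2 * i + 3)) * tailMoment i h w

/-! ### Estimates and continuity for the gain operator. -/

theorem tailWeight_pos (i : ℕ) {z : ℝ} (hz : 0 < z) : 0 < tailWeight i z := by
  unfold tailWeight; positivity

theorem measurable_tailWeight (i : ℕ) : Measurable (tailWeight i) := by
  unfold tailWeight; fun_prop

theorem pow_mul_exp_neg_le {x : ℝ} (hx : 0 ≤ x) (n : ℕ) :
    x ^ n * Real.exp (-x) ≤ 2 ^ n * n.factorial * Real.exp (-x / 2) := by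
  have h := Real.pow_div_factorial_le_exp (x / 2) (by positivity) n
  have h2 : x ^ n ≤ 2 ^ n * n.factorial * Real.exp (x / 2) := by
    rw [div_pow, div_div, div_le_iff₀ (by positivity)] at h
    linarith
  calc x ^ n * Real.exp (-x) ≤ 2 ^ n * n.factorial * Real.exp (x / 2) * Real.exp (-x) := by gcongr
    _ = _ := by rw [mul_assoc, ← Real.exp_add]; ring_nf

/-- The growing factor is absorbed because `z^(2i+3) - w^(2i+3) ≥ z^(2i+2) (z-w)`. The factor
`(1+w^2)⁻¹` makes the bound integrable in `w`, and the exponential makes it integrable in `z`. -/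
theorem gain_kernel_bound (i : ℕ) : ∃ C : ℝ, 0 < C ∧ ∀ w z : ℝ, 0 < w → w < z →
    w ^ (i + 2) * Real.exp (w ^ (2 * i + 3)) * ((z - w) ^ (i + 1) * tailWeight i z)
      ≤ C * (1 + w ^ 2)⁻¹ * Real.exp (-(z - w) / 2) := by
  refine ⟨4 * (2 ^ (i + 1) * (i + 1).factorial), by positivity, fun w z hw hwz => ?_⟩
  set C₀ : ℝ := 2 ^ (i + 1) * (i + 1).factorial with hC₀
  have hC₀1 : 1 ≤ C₀ := by
    have h1 : (1 : ℝ) ≤ 2 ^ (i + 1) := one_le_pow₀ (by norm_num)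
    have h2 : (1 : ℝ) ≤ (i + 1).factorial := by exact_mod_cast Nat.one_le_iff_ne_zero.2 (Nat.factorial_ne_zero _)
    nlinarith
  have hz : 0 < z := hw.trans hwz
  have hu : 0 < z - w := sub_pos.2 hwz
  have hexp : Real.exp (w ^ (2 * i + 3)) * Real.exp (-z ^ (2 * i + 3)) ≤
      Real.exp (-(z ^ (2 * i + 2) * (z - w))) := by
    rw [← Real.exp_add]
    apply Real.exp_le_exp.2
    have : w ^ (2 * i + 2) ≤ z ^ (2 * i + 2) := by gcongr
    have := mul_le_mul_of_nonneg_right this hw.le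
    have e1 : w ^ (2 * i + 3) = w ^ (2 * i + 2) * w := pow_succ _ _
    have e2 : z ^ (2 * i + 3) = z ^ (2 * i + 2) * z := pow_succ _ _
    rw [e1, e2]; linarith
  have hpoly : (1 + w ^ 2) * (w ^ (i + 2) / z ^ 2) ≤ z ^ i + z ^ (i + 2) := by
    have h1 : w ^ (i + 2) / z ^ 2 ≤ z ^ i := by
      rw [div_le_iff₀ (by positivity), ← pow_add]; gcongr
    calc (1 + w ^ 2) * (w ^ (i + 2) / z ^ 2) ≤ (1 + z ^ 2) * z ^ i := by gcongr
      _ = _ := by ring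
  have main : (z ^ i + z ^ (i + 2)) * (z - w) ^ (i + 1) *
      Real.exp (-(z ^ (2 * i + 2) * (z - w))) ≤ 4 * C₀ * Real.exp (-(z - w) / 2) := by
    rcases le_total z 1 with hz1 | hz1
    · have a1 : z ^ i ≤ 1 := pow_le_one₀ hz.le hz1
      have a2 : z ^ (i + 2) ≤ 1 := pow_le_one₀ hz.le hz1
      have a3 : (z - w) ^ (i + 1) ≤ 1 := pow_le_one₀ hu.le (by linarith)
      have a4 : Real.exp (-(z ^ (2 * i + 2) * (z - w))) ≤ 1 :=
        Real.exp_le_one_iff.2 (neg_nonpos.2 (by positivity))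
      have a5 : 1 / 2 ≤ Real.exp (-(z - w) / 2) := by
        have := Real.add_one_le_exp (-(z - w) / 2)
        linarith
      calc _ ≤ (1 + 1) * 1 * (1 : ℝ) := by gcongr
        _ ≤ 4 * C₀ * (1 / 2) := by linarith
        _ ≤ _ := by gcongr
    -- For `z ≥ 1` all powers fit into `x^(i+1)`, since `(2i+2)(i+1) ≥ i+2`; half of the decay
    -- `exp(-x)` pays for them.
    · set x := z ^ (2 * i + 2) * (z - w) with hx
      have hx0 : 0 ≤ x := by positivity
      have b1 : z ^ i ≤ z ^ (i + 2) := pow_le_pow_right₀ hz1 (by omega)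
      have b2 : z ^ (i + 2) * (z - w) ^ (i + 1) ≤ x ^ (i + 1) := by
        rw [hx, mul_pow, ← pow_mul]
        gcongr
        nlinarith
      have b3 : z - w ≤ x := le_mul_of_one_le_left hu.le (one_le_pow₀ hz1)
      calc _ ≤ (z ^ (i + 2) + z ^ (i + 2)) * (z - w) ^ (i + 1) * Real.exp (-x) := by gcongr
        _ = 2 * (z ^ (i + 2) * (z - w) ^ (i + 1)) * Real.exp (-x) := by ring
        _ ≤ 2 * x ^ (i + 1) * Real.exp (-x) := by gcongr
        _ = 2 * (x ^ (i + 1) * Real.exp (-x)) := by ring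
        _ ≤ 2 * (C₀ * Real.exp (-x / 2)) := by
          exact mul_le_mul_of_nonneg_left (pow_mul_exp_neg_le hx0 _) (by norm_num)
        _ ≤ 2 * (C₀ * Real.exp (-(z - w) / 2)) := by gcongr
        _ ≤ _ := by nlinarith [mul_pos (lt_of_lt_of_le one_pos hC₀1) (Real.exp_pos (-(z - w) / 2))]
  have h1w : 0 < 1 + w ^ 2 := by positivity
  rw [mul_right_comm (4 * C₀), ← div_eq_mul_inv, le_div_iff₀ h1w]
  calc _ = ((1 + w ^ 2) * (w ^ (i + 2) / z ^ 2)) * (z - w) ^ (i + 1) *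
        (Real.exp (w ^ (2 * i + 3)) * Real.exp (-z ^ (2 * i + 3))) := by
        unfold tailWeight; ring
    _ ≤ (z ^ i + z ^ (i + 2)) * (z - w) ^ (i + 1) *
        Real.exp (-(z ^ (2 * i + 2) * (z - w))) := by gcongr
    _ ≤ _ := main

theorem integrableOn_pow_mul_exp_neg_mul_pow {b : ℝ} (hb : 0 < b) (n i : ℕ) :
    IntegrableOn (fun z : ℝ => z ^ n * Real.exp (-b * z ^ (2 * i + 3))) (Ioi 0) := by
  have h := integrableOn_rpow_mul_exp_neg_mul_rpow (p := ((2 * i + 3 : ℕ) : ℝ)) (s := (n : ℝ)) (b := b)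
    (by linarith [n.cast_nonneg (α := ℝ)]) (by positivity) hb
  simpa only [Real.rpow_natCast] using h

theorem integral_exp_neg_sub_div_two (w : ℝ) :
    IntegrableOn (fun z : ℝ => Real.exp (-(z - w) / 2)) (Ioi w) ∧
      ∫ z in Ioi w, Real.exp (-(z - w) / 2) = 2 := by
  have e : (fun z : ℝ => Real.exp (-(z - w) / 2)) =
      fun z => Real.exp (w / 2) * Real.exp ((-1 / 2) * z) := by
    ext z; rw [← Real.exp_add]; ring_nf
  rw [e]
  refine ⟨(integrableOn_exp_mul_Ioi (by norm_num) w).const_mul _, ?_⟩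
  rw [integral_const_mul, integral_exp_mul_Ioi (by norm_num), mul_div_assoc', mul_neg,
    ← Real.exp_add]
  ring_nf; norm_num

/-- The positive part `max (z - w) 0` lets the domain of integration stay fixed while `w` varies,
and the bound depends on `w` only through `a`. This is what dominated convergence needs. -/
theorem norm_tailMoment_integrand_le (i : ℕ) {h : ℝ → ℝ} {M a w z : ℝ} (ha : 0 < a) (haw : a ≤ w)
    (hM : |h z| ≤ M) (hz : 0 < z) :
    ‖(max (z - w) 0) ^ (i + 1) * (tailWeight i z * h z)‖ ≤
      M / a ^ 2 * (z ^ (i + 1) * Real.exp (-1 * z ^ (2 * i + 3))) := by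
  have hM0 : 0 ≤ M := (abs_nonneg _).trans hM
  rcases le_total z w with hzw | hzw
  · rw [max_eq_right (by linarith), zero_pow (by omega), zero_mul, norm_zero]
    positivity
  · rw [max_eq_left (by linarith), norm_mul, norm_mul, Real.norm_eq_abs, Real.norm_eq_abs,
      Real.norm_eq_abs, abs_of_pos (tailWeight_pos i hz), abs_of_nonneg (by have := sub_nonneg.2 hzw; positivity)]
    calc (z - w) ^ (i + 1) * (tailWeight i z * |h z|)
        ≤ z ^ (i + 1) * (Real.exp (-z ^ (2 * i + 3)) / a ^ 2 * M) := by
          unfold tailWeight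
          have := sub_nonneg.2 hzw
          gcongr <;> linarith
      _ = _ := by rw [neg_one_mul]; ring

theorem setIntegral_Ioi_max_eq_tailMoment (i : ℕ) (h : ℝ → ℝ) {y w : ℝ} (hw : y ≤ w) :
    ∫ z in Ioi y, (max (z - w) 0) ^ (i + 1) * (tailWeight i z * h z) = tailMoment i h w := by
  have hsub : Ioi w ⊆ Ioi y := Ioi_subset_Ioi hw
  rw [tailMoment, setIntegral_eq_of_subset_of_forall_sdiff_eq_zero measurableSet_Ioi hsub]
  · refine setIntegral_congr_fun measurableSet_Ioi fun z hz => ?_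
    simp only [mem_Ioi] at hz
    rw [max_eq_left (by linarith)]
  · intro z hz
    rw [max_eq_right (by have := not_lt.1 (mem_Ioi.not.1 hz.2); linarith), zero_pow (by omega),
      zero_mul]

theorem aestronglyMeasurable_max_pow_mul (i : ℕ) {h : ℝ → ℝ} (hc : Continuous h) (w : ℝ)
    (μ : Measure ℝ) : AEStronglyMeasurable
      (fun z : ℝ => (max (z - w) 0) ^ (i + 1) * (tailWeight i z * h z)) μ := by
  have := measurable_tailWeight i
  have := hc.measurable
  exact Measurable.aestronglyMeasurable (by fun_prop)

theorem continuousOn_tailMoment (i : ℕ) {h : ℝ → ℝ} (hc : Continuous h) {M : ℝ}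
    (hM : ∀ z, |h z| ≤ M) : ContinuousOn (tailMoment i h) (Ioi 0) := by
  intro w₀ hw₀
  have hw₀ : 0 < w₀ := hw₀
  apply ContinuousAt.continuousWithinAt
  have key : ContinuousAt (fun w => ∫ z in Ioi (0 : ℝ), (max (z - w) 0) ^ (i + 1) *
      (tailWeight i z * h z)) w₀ := by
    refine continuousAt_of_dominated (bound := fun z => M / (w₀ / 2) ^ 2 *
      (z ^ (i + 1) * Real.exp (-1 * z ^ (2 * i + 3)))) ?_ ?_ ?_ ?_
    · exact .of_forall fun w => aestronglyMeasurable_max_pow_mul i hc w _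
    · filter_upwards [lt_mem_nhds (half_lt_self hw₀)] with w hw
      filter_upwards [ae_restrict_mem measurableSet_Ioi] with z hz
      exact norm_tailMoment_integrand_le i (by positivity) hw.le (hM z) hz
    · exact (integrableOn_pow_mul_exp_neg_mul_pow one_pos _ i).const_mul _
    · exact .of_forall fun z => by fun_prop
  refine key.congr ?_
  filter_upwards [lt_mem_nhds hw₀] with w hw
  exact setIntegral_Ioi_max_eq_tailMoment i h hw.le

theorem integrableOn_tailMoment_integrand (i : ℕ) {h : ℝ → ℝ} (hc : Continuous h) {M w : ℝ}
    (hw : 0 < w) (hM : ∀ z, |h z| ≤ M) :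
    IntegrableOn (fun z => (z - w) ^ (i + 1) * (tailWeight i z * h z)) (Ioi w) := by
  have h1 : IntegrableOn (fun z => (max (z - w) 0) ^ (i + 1) * (tailWeight i z * h z)) (Ioi 0) := by
    refine Integrable.mono' (g := fun z => M / w ^ 2 *
      (z ^ (i + 1) * Real.exp (-1 * z ^ (2 * i + 3)))) ?_ ?_ ?_
    · exact (integrableOn_pow_mul_exp_neg_mul_pow one_pos _ i).const_mul _
    · exact aestronglyMeasurable_max_pow_mul i hc w _
    · filter_upwards [ae_restrict_mem measurableSet_Ioi] with z hz
      exact norm_tailMoment_integrand_le i hw le_rfl (hM z) hz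
  refine (h1.mono_set (Ioi_subset_Ioi hw.le)).congr_fun (fun z hz => ?_) measurableSet_Ioi
  simp only [mem_Ioi] at hz
  simp only
  rw [max_eq_left (by linarith)]

theorem continuousOn_gain (i : ℕ) {h : ℝ → ℝ} (hc : Continuous h) {M : ℝ}
    (hM : ∀ z, |h z| ≤ M) : ContinuousOn (gain i h) (Ioi 0) :=
  ContinuousOn.mul (by fun_prop) (continuousOn_tailMoment i hc hM)

/-- The bound on `h` is required only beyond `w`: the equation looks towards infinity, and a
decreasing weight can therefore be evaluated at `w`. -/
theorem gain_bound (i : ℕ) : ∃ C : ℝ, 0 < C ∧ ∀ (h : ℝ → ℝ) (D w : ℝ), 0 < w →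
    (∀ z, w < z → |h z| ≤ D) → |gain i h w| ≤ C * D * (1 + w ^ 2)⁻¹ := by
  obtain ⟨C, hC, hker⟩ := gain_kernel_bound i
  refine ⟨2 * C, by positivity, fun h D w hw hD => ?_⟩
  have hD0 : 0 ≤ D := (abs_nonneg _).trans (hD (w + 1) (by linarith))
  obtain ⟨hint, hval⟩ := integral_exp_neg_sub_div_two w
  rw [gain, tailMoment, ← integral_const_mul, ← Real.norm_eq_abs]
  refine (norm_integral_le_of_norm_le (hint.const_mul (C * (1 + w ^ 2)⁻¹ * D)) ?_).trans_eq ?_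
  · filter_upwards [ae_restrict_mem measurableSet_Ioi] with z hz
    have hz : w < z := hz
    have hz0 : 0 < z := hw.trans hz
    have h1 := hker w z hw hz
    have h2 : 0 ≤ w ^ (i + 2) * Real.exp (w ^ (2 * i + 3)) * ((z - w) ^ (i + 1) * tailWeight i z) := by
      have := sub_pos.2 hz
      have := tailWeight_pos i hz0
      positivity
    calc _ = (w ^ (i + 2) * Real.exp (w ^ (2 * i + 3)) * ((z - w) ^ (i + 1) * tailWeight i z)) *
          |h z| := by
          rw [Real.norm_eq_abs, ← abs_of_nonneg h2, ← abs_mul, mul_assoc, mul_assoc, mul_assoc, mul_assoc]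
      _ ≤ (C * (1 + w ^ 2)⁻¹ * Real.exp (-(z - w) / 2)) * D := by
          gcongr; exact hD z hz
      _ = _ := by ring
  · rw [integral_const_mul, hval]; ring

theorem integrableOn_gain (i : ℕ) {h : ℝ → ℝ} (hc : Continuous h) {M : ℝ}
    (hM : ∀ z, |h z| ≤ M) : IntegrableOn (gain i h) (Ioi 0) := by
  obtain ⟨C, hC, hb⟩ := gain_bound i
  refine Integrable.mono' (integrable_inv_one_add_sq.integrableOn.const_mul (C * M))
    ((continuousOn_gain i hc hM).aestronglyMeasurable measurableSet_Ioi) ?_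
  filter_upwards [ae_restrict_mem measurableSet_Ioi] with w hw
  exact hb h M w hw fun z _ => hM z

theorem gain_sub (i : ℕ) {h₁ h₂ : ℝ → ℝ} (hc₁ : Continuous h₁) (hc₂ : Continuous h₂) {M₁ M₂ : ℝ}
    (hM₁ : ∀ z, |h₁ z| ≤ M₁) (hM₂ : ∀ z, |h₂ z| ≤ M₂) {w : ℝ} (hw : 0 < w) :
    gain i (fun z => h₁ z - h₂ z) w = gain i h₁ w - gain i h₂ w := by
  simp only [gain, tailMoment]
  rw [← mul_sub, ← integral_sub (integrableOn_tailMoment_integrand i hc₁ hw hM₁)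
    (integrableOn_tailMoment_integrand i hc₂ hw hM₂)]
  simp only [mul_sub]

/-! ### The Volterra equation from infinity, solved by contraction. -/

open scoped BoundedContinuousFunction

theorem hasDerivAt_exp_neg_mul_arctan (l x : ℝ) :
    HasDerivAt (fun y => Real.exp (-l * Real.arctan y))
      (-(l * (1 + x ^ 2)⁻¹ * Real.exp (-l * Real.arctan x))) x := by
  have h := ((Real.hasDerivAt_arctan x).const_mul (-l)).exp
  convert h using 1
  rw [one_div]; ring

/-- Since `arctan' = (1+x^2)⁻¹`, the weight `exp(-l arctan)` reproduces itself with a gain of `1/l`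
when integrated against the bound on the gain term. -/
theorem integral_inv_one_add_sq_mul_exp_neg_mul_arctan {l : ℝ} (hl : 0 < l) (a : ℝ) :
    IntegrableOn (fun x => (1 + x ^ 2)⁻¹ * Real.exp (-l * Real.arctan x)) (Ioi a) ∧
    ∫ x in Ioi a, (1 + x ^ 2)⁻¹ * Real.exp (-l * Real.arctan x) ≤
      Real.exp (-l * Real.arctan a) / l := by
  have ht : Tendsto (fun y => Real.exp (-l * Real.arctan y)) atTop
      (𝓝 (Real.exp (-l * (Real.pi / 2)))) :=
    (Real.continuous_exp.tendsto _).comp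
      ((Real.tendsto_arctan_atTop.mono_right nhdsWithin_le_nhds).const_mul _)
  have hneg : ∀ x ∈ Ioi a, -(l * (1 + x ^ 2)⁻¹ * Real.exp (-l * Real.arctan x)) ≤ 0 :=
    fun x _ => neg_nonpos.2 (by positivity)
  have hint := integrableOn_Ioi_deriv_of_nonpos'
    (fun x _ => hasDerivAt_exp_neg_mul_arctan l x) hneg ht
  have hval := integral_Ioi_of_hasDerivAt_of_nonpos'
    (fun x _ => hasDerivAt_exp_neg_mul_arctan l x) hneg ht
  have e : (fun x => -(l * (1 + x ^ 2)⁻¹ * Real.exp (-l * Real.arctan x))) =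
      fun x => (-l) * ((1 + x ^ 2)⁻¹ * Real.exp (-l * Real.arctan x)) := by
    ext x; ring
  rw [e] at hint
  have hint' := hint.const_mul (-l)⁻¹
  simp only [← mul_assoc, inv_mul_cancel₀ (neg_ne_zero.2 hl.ne'), one_mul] at hint'
  refine ⟨hint', ?_⟩
  rw [e, integral_const_mul] at hval
  rw [le_div_iff₀ hl]
  have := Real.exp_pos (-l * (Real.pi / 2))
  linarith

theorem continuous_integral_Ioi_max {f : ℝ → ℝ} (hf : IntegrableOn f (Ioi 0)) :
    Continuous fun y : ℝ => ∫ w in Ioi (max y 0), f w := by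
  have hii : ∀ a b : ℝ, IntervalIntegrable (indicator (Ioi 0) f) volume a b :=
    fun a b => ((integrable_indicator_iff measurableSet_Ioi).2 hf).intervalIntegrable
  have e : (fun y : ℝ => ∫ w in Ioi (max y 0), f w) =
      fun y => (∫ w in Ioi 0, f w) - ∫ w in (0 : ℝ)..max y 0, indicator (Ioi 0) f w := by
    ext y
    have h0 : (0 : ℝ) ≤ max y 0 := le_max_right _ _
    rw [intervalIntegral.integral_of_le h0, setIntegral_congr_fun (g := f) measurableSet_Ioc
      (fun w hw => indicator_of_mem (show w ∈ Ioi (0 : ℝ) from hw.1) f),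
      ← Ioc_union_Ioi_eq_Ioi h0, setIntegral_union Ioc_disjoint_Ioi_same measurableSet_Ioi
        (hf.mono_set Ioc_subset_Ioi_self) (hf.mono_set (Ioi_subset_Ioi h0))]
    ring
  rw [e]
  exact continuous_const.sub
    ((intervalIntegral.continuous_primitive hii 0).comp (continuous_id.max continuous_const))

/-- Existence of a bounded continuous solution of the Volterra equation from infinity. -/
theorem exists_relative_profile (i : ℕ) {c : ℝ} (hc : 0 < c) :
    ∃ h : ℝ → ℝ, Continuous h ∧ (∃ M, ∀ z, |h z| ≤ M) ∧
      ∀ y, 0 ≤ y → h y = 1 - c * ∫ w in Ioi y, gain i h w := by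
  obtain ⟨C, hC, hb⟩ := gain_bound i
  -- The Lipschitz constant will be `c * C / l`, so this choice makes it `1/2`.
  set l : ℝ := 2 * (c * C) with hl_def
  have hl : 0 < l := by positivity
  set m : ℝ → ℝ := fun y => Real.exp (-l * Real.arctan y) with hm_def
  have hm_cont : Continuous m := by fun_prop
  have hm_pos : ∀ y, 0 < m y := fun y => Real.exp_pos _
  have hm_anti : ∀ a b, a ≤ b → m b ≤ m a := fun a b hab => by
    have := Real.arctan_mono hab
    apply Real.exp_le_exp.2
    nlinarith
  set B := Real.exp (l * (Real.pi / 2))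
  have hm_le : ∀ y, m y ≤ B := fun y => Real.exp_le_exp.2 (by
    have := Real.neg_pi_div_two_lt_arctan y
    nlinarith)
  have hm_inv : ∀ y, (m y)⁻¹ ≤ B := fun y => by
    rw [← Real.exp_neg]
    exact Real.exp_le_exp.2 (by
      have := Real.arctan_lt_pi_div_two y
      nlinarith)
  have hvc : ∀ v : ℝ →ᵇ ℝ, Continuous fun z => v z * m z := fun v => v.continuous.mul hm_cont
  have hvb : ∀ (v : ℝ →ᵇ ℝ) z, |v z * m z| ≤ ‖v‖ * B := fun v z => by
    rw [abs_mul, abs_of_pos (hm_pos z)]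
    exact mul_le_mul (v.norm_coe_le_norm z) (hm_le z) (hm_pos z).le (norm_nonneg _)
  have hgi : ∀ v : ℝ →ᵇ ℝ, IntegrableOn (gain i fun z => v z * m z) (Ioi 0) :=
    fun v => integrableOn_gain i (hvc v) (hvb v)
  -- The unknown is `v = h / m`, so that the plain sup norm of `v` is the weighted norm of `h`.
  -- Clamping at zero makes `F v` continuous on the whole line; only `y ≥ 0` matters.
  let F : (ℝ →ᵇ ℝ) → ℝ → ℝ :=
    fun v y => (m y)⁻¹ * (1 - c * ∫ w in Ioi (max y 0), gain i (fun z => v z * m z) w)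
  have hFc : ∀ v, Continuous (F v) := fun v =>
    (hm_cont.inv₀ fun y => (hm_pos y).ne').mul
      (continuous_const.sub (continuous_const.mul (continuous_integral_Ioi_max (hgi v))))
  have hFb : ∀ v y, ‖F v y‖ ≤ B * (1 + c * ∫ w in Ioi 0, |gain i (fun z => v z * m z) w|) := by
    intro v y
    have h1 : |∫ w in Ioi (max y 0), gain i (fun z => v z * m z) w| ≤
        ∫ w in Ioi 0, |gain i (fun z => v z * m z) w| :=
      (abs_integral_le_integral_abs).trans
        (setIntegral_mono_set (hgi v).abs (.of_forall fun _ => abs_nonneg _)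
          (Ioi_subset_Ioi (le_max_right _ _)).eventuallyLE)
    have h2 : |1 - c * ∫ w in Ioi (max y 0), gain i (fun z => v z * m z) w| ≤
        1 + c * ∫ w in Ioi 0, |gain i (fun z => v z * m z) w| := by
      refine (abs_sub _ _).trans ?_
      rw [abs_one, abs_mul, abs_of_pos hc]
      gcongr
    rw [Real.norm_eq_abs, abs_mul, abs_of_pos (inv_pos.2 (hm_pos y))]
    exact mul_le_mul (hm_inv y) h2 (abs_nonneg _) (Real.exp_pos _).le
  let T : (ℝ →ᵇ ℝ) → (ℝ →ᵇ ℝ) := fun v =>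
    BoundedContinuousFunction.ofNormedAddCommGroup (F v) (hFc v) _ (hFb v)
  have hT : ContractingWith (1 / 2) T := by
    refine ⟨by norm_num, LipschitzWith.of_dist_le_mul fun v₁ v₂ => ?_⟩
    rw [BoundedContinuousFunction.dist_le (by positivity)]
    intro y
    set y₀ := max y 0
    have hy₀ : 0 ≤ y₀ := le_max_right _ _
    obtain ⟨hint, hval⟩ := integral_inv_one_add_sq_mul_exp_neg_mul_arctan hl y₀
    have hsub : Ioi y₀ ⊆ Ioi 0 := Ioi_subset_Ioi hy₀
    have hdiff : |(∫ w in Ioi y₀, gain i (fun z => v₂ z * m z) w) -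
        ∫ w in Ioi y₀, gain i (fun z => v₁ z * m z) w| ≤ C * dist v₁ v₂ * (m y₀ / l) := by
      rw [← integral_sub ((hgi v₂).mono_set hsub) ((hgi v₁).mono_set hsub), ← Real.norm_eq_abs]
      refine (norm_integral_le_of_norm_le (hint.const_mul (C * dist v₁ v₂)) ?_).trans ?_
      · filter_upwards [ae_restrict_mem measurableSet_Ioi] with w hw
        have hw0 : 0 < w := hsub hw
        rw [← gain_sub i (hvc v₂) (hvc v₁) (hvb v₂) (hvb v₁) hw0, Real.norm_eq_abs]
        -- As `m` decreases, its value at `w` dominates all its values beyond `w`.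
        refine (hb _ (dist v₁ v₂ * m w) w hw0 fun z hz => ?_).trans_eq ?_
        · rw [← sub_mul, abs_mul, abs_of_pos (hm_pos z)]
          refine mul_le_mul ?_ (hm_anti _ _ hz.le) (hm_pos z).le dist_nonneg
          rw [dist_comm, ← Real.dist_eq]
          exact BoundedContinuousFunction.dist_coe_le_dist z
        · ring
      · rw [integral_const_mul]
        gcongr
    change dist (F v₁ y) (F v₂ y) ≤ _
    have e : F v₁ y - F v₂ y = (m y)⁻¹ * (c * ((∫ w in Ioi y₀, gain i (fun z => v₂ z * m z) w) -
        ∫ w in Ioi y₀, gain i (fun z => v₁ z * m z) w)) := by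
      simp only [F]; ring
    rw [Real.dist_eq, e, abs_mul, abs_mul, abs_of_pos hc, abs_of_pos (inv_pos.2 (hm_pos y))]
    calc _ ≤ (m y)⁻¹ * (c * (C * dist v₁ v₂ * (m y / l))) := by
          have := hm_anti y y₀ (le_max_left _ _)
          have := hm_pos y
          gcongr
          refine hdiff.trans ?_
          gcongr
      _ = 1 / 2 * dist v₁ v₂ := by
          have := (hm_pos y).ne'
          rw [hl_def]; field_simp
      _ = _ := by norm_num
  refine ⟨fun z => hT.fixedPoint T z * m z, hvc _, ⟨_, hvb _⟩, fun y hy => ?_⟩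
  have hfix : T (hT.fixedPoint T) y = hT.fixedPoint T y :=
    congrArg (fun u : ℝ →ᵇ ℝ => u y) hT.fixedPoint_isFixedPt
  change F _ y = _ at hfix
  simp only [← hfix]
  simp only [F, max_eq_left hy]
  have := (hm_pos y).ne'
  field_simp

/-! ### Beta integrals and the exchange of integrals. -/

theorem integral_pow_mul_sub_pow (i : ℕ) {z : ℝ} (hz : 0 < z) :
    ∫ w in (0 : ℝ)..z, w ^ (i + 1) * (z - w) ^ (i + 1) =
      ProbabilityTheory.beta ((i : ℝ) + 2) ((i : ℝ) + 2) * z ^ (2 * i + 3) := by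
  have h := Complex.betaIntegral_scaled ((i : ℂ) + 2) ((i : ℂ) + 2) hz
  have e1 : (i : ℂ) + 2 - 1 = ((i + 1 : ℕ) : ℂ) := by push_cast; ring
  have e2 : (i : ℂ) + 2 + ((i : ℂ) + 2) - 1 = ((2 * i + 3 : ℕ) : ℂ) := by push_cast; ring
  rw [e1, e2] at h
  simp only [Complex.cpow_natCast] at h
  have e3 : ∀ x : ℝ, (x : ℂ) ^ (i + 1) * ((z : ℂ) - x) ^ (i + 1) =
      ((x ^ (i + 1) * (z - x) ^ (i + 1) : ℝ) : ℂ) := fun x => by push_cast; ring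
  simp only [e3] at h
  rw [intervalIntegral.integral_ofReal] at h
  have hi : (0 : ℝ) < (i : ℝ) + 2 := by positivity
  rw [ProbabilityTheory.beta_eq_betaIntegralReal _ _ hi hi]
  have h' := congrArg Complex.re h
  rw [Complex.ofReal_re, ← Complex.ofReal_pow, Complex.re_ofReal_mul] at h'
  rw [h', mul_comm]
  push_cast
  rfl

/-- The reflection `w ↦ z - w` shows that a daughter has mean width `z/2`. This is conservation of
length under fragmentation. -/
theorem two_mul_integral_pow_mul_sub_pow (i : ℕ) {z : ℝ} (hz : 0 < z) :
    2 * ∫ w in (0 : ℝ)..z, w ^ (i + 2) * (z - w) ^ (i + 1) =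
      ProbabilityTheory.beta ((i : ℝ) + 2) ((i : ℝ) + 2) * z ^ (2 * i + 4) := by
  have h1 : ∫ w in (0 : ℝ)..z, w ^ (i + 2) * (z - w) ^ (i + 1) =
      ∫ w in (0 : ℝ)..z, (z - w) ^ (i + 2) * w ^ (i + 1) := by
    have := intervalIntegral.integral_comp_sub_left (a := 0) (b := z)
      (fun w : ℝ => w ^ (i + 2) * (z - w) ^ (i + 1)) z
    simp only [sub_sub_cancel, sub_zero, sub_self] at this
    exact this.symm
  have h2 : (∫ w in (0 : ℝ)..z, w ^ (i + 2) * (z - w) ^ (i + 1)) +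
      (∫ w in (0 : ℝ)..z, (z - w) ^ (i + 2) * w ^ (i + 1)) =
      ∫ w in (0 : ℝ)..z, z * (w ^ (i + 1) * (z - w) ^ (i + 1)) := by
    rw [← intervalIntegral.integral_add
      (Continuous.intervalIntegrable (by fun_prop) _ _)
      (Continuous.intervalIntegrable (by fun_prop) _ _)]
    congr 1 with w
    ring
  rw [intervalIntegral.integral_const_mul, integral_pow_mul_sub_pow i hz] at h2
  rw [two_mul]
  nth_rewrite 2 [h1]
  rw [h2]; ring

/-- The length of daughter gaps of width at most `y` created from a parent of width `z`, up to
the factor `2`. -/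
noncomputable def smallDaughters (i : ℕ) (y z : ℝ) : ℝ :=
  ∫ w in (0 : ℝ)..y, w ^ (i + 2) * (z - w) ^ (i + 1)

theorem integral_Ioi_pow_mul_max_pow (i : ℕ) {y z : ℝ} (hyz : y ≤ z) :
    ∫ w in Ioi y, w ^ (i + 2) * (max (z - w) 0) ^ (i + 1) =
      ∫ w in y..z, w ^ (i + 2) * (z - w) ^ (i + 1) := by
  rw [intervalIntegral.integral_of_le hyz,
    setIntegral_eq_of_subset_of_forall_sdiff_eq_zero measurableSet_Ioi
      (Ioc_subset_Ioi_self : Ioc y z ⊆ Ioi y)]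
  · refine setIntegral_congr_fun measurableSet_Ioc fun w hw => ?_
    rw [max_eq_left (sub_nonneg.2 hw.2)]
  · intro w hw
    have : z < w := by
      by_contra! hcon
      exact hw.2 ⟨hw.1, hcon⟩
    rw [max_eq_right (by linarith), zero_pow (by omega), mul_zero]

theorem integrable_gain_prod (i : ℕ) {h : ℝ → ℝ} (hc : Continuous h) {M y : ℝ} (hy : 0 < y)
    (hM : ∀ z, |h z| ≤ M) :
    Integrable (Function.uncurry fun w z : ℝ =>
      w ^ (i + 2) * ((max (z - w) 0) ^ (i + 1) * (tailWeight i z * h z)))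
      ((volume.restrict (Ioi y)).prod (volume.restrict (Ioi y))) := by
  have hI : ∀ n : ℕ, Integrable (fun z : ℝ => z ^ n * Real.exp (-(1 / 2) * z ^ (2 * i + 3)))
      (volume.restrict (Ioi y)) := fun n =>
    (integrableOn_pow_mul_exp_neg_mul_pow (by norm_num) n i).mono_set (Ioi_subset_Ioi hy.le)
  have hdom := ((hI (i + 2)).mul_prod (hI (i + 1))).const_mul (M / y ^ 2)
  refine hdom.mono' ?_ ?_
  · have := measurable_tailWeight i
    have := hc.measurable
    apply Measurable.aestronglyMeasurable
    unfold Function.uncurry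
    fun_prop
  · rw [Measure.prod_restrict]
    filter_upwards [ae_restrict_mem (measurableSet_Ioi.prod measurableSet_Ioi)] with p hp
    obtain ⟨w, z⟩ := p
    have hw : y < w := hp.1
    have hz : y < z := hp.2
    have hw0 := hy.trans hw
    have hz0 := hy.trans hz
    have hM0 : 0 ≤ M := (abs_nonneg _).trans (hM z)
    simp only [Function.uncurry]
    rcases le_total z w with hzw | hzw
    · rw [max_eq_right (by linarith), zero_pow (by omega), zero_mul, mul_zero, norm_zero]
      positivity
    · rw [norm_mul, Real.norm_eq_abs, abs_of_pos (by positivity)]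
      calc _ ≤ w ^ (i + 2) * (M / y ^ 2 * (z ^ (i + 1) * Real.exp (-1 * z ^ (2 * i + 3)))) := by
            gcongr
            exact norm_tailMoment_integrand_le i hy hw.le (hM z) hz0
        -- On `w ≤ z` the decay in `z` is shared equally between both variables, which gives an
        -- integrable product.
        _ ≤ w ^ (i + 2) * (M / y ^ 2 * (z ^ (i + 1) *
            (Real.exp (-(1 / 2) * w ^ (2 * i + 3)) * Real.exp (-(1 / 2) * z ^ (2 * i + 3))))) := by
            rw [← Real.exp_add]
            have : w ^ (2 * i + 3) ≤ z ^ (2 * i + 3) := by gcongr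
            gcongr
            linarith
        _ = _ := by ring

theorem gain_fubini (i : ℕ) {h : ℝ → ℝ} (hc : Continuous h) {M y : ℝ} (hy : 0 < y)
    (hM : ∀ z, |h z| ≤ M) :
    IntegrableOn (fun w => w ^ (i + 2) * tailMoment i h w) (Ioi y) ∧
    IntegrableOn (fun z => (∫ w in y..z, w ^ (i + 2) * (z - w) ^ (i + 1)) *
      (tailWeight i z * h z)) (Ioi y) ∧
    ∫ w in Ioi y, w ^ (i + 2) * tailMoment i h w =
      ∫ z in Ioi y, (∫ w in y..z, w ^ (i + 2) * (z - w) ^ (i + 1)) * (tailWeight i z * h z) := by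
  have hP := integrable_gain_prod i hc hy hM
  have e1 : ∀ w ∈ Ioi y, ∫ z in Ioi y,
      w ^ (i + 2) * ((max (z - w) 0) ^ (i + 1) * (tailWeight i z * h z)) =
      w ^ (i + 2) * tailMoment i h w := fun w hw => by
    rw [integral_const_mul, setIntegral_Ioi_max_eq_tailMoment i h (le_of_lt hw)]
  have e2 : ∀ z ∈ Ioi y, ∫ w in Ioi y,
      w ^ (i + 2) * ((max (z - w) 0) ^ (i + 1) * (tailWeight i z * h z)) =
      (∫ w in y..z, w ^ (i + 2) * (z - w) ^ (i + 1)) * (tailWeight i z * h z) := fun z hz => by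
    simp only [← mul_assoc]
    rw [integral_mul_const, integral_mul_const, integral_Ioi_pow_mul_max_pow i (le_of_lt hz)]
  refine ⟨?_, ?_, ?_⟩
  · exact IntegrableOn.congr_fun (hP.integral_prod_left) e1 measurableSet_Ioi
  · exact IntegrableOn.congr_fun (hP.integral_prod_right) e2 measurableSet_Ioi
  · rw [← setIntegral_congr_fun measurableSet_Ioi e1, ← setIntegral_congr_fun measurableSet_Ioi e2]
    exact integral_integral_swap hP

/-! ### Properties of the relative profile and the flux identity. -/

/-- A bounded solution of the equation for the relative profile, normalised at infinity. -/
structure IsRelativeProfile (i : ℕ) (c : ℝ) (h : ℝ → ℝ) : Prop where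
  continuous : Continuous h
  bounded : ∃ M, ∀ z, |h z| ≤ M
  eq_one_sub : ∀ y, 0 ≤ y → h y = 1 - c * ∫ w in Ioi y, gain i h w

namespace IsRelativeProfile

variable {i : ℕ} {c : ℝ} {h : ℝ → ℝ}

theorem integrableOn_gain (H : IsRelativeProfile i c h) : IntegrableOn (gain i h) (Ioi 0) :=
  let ⟨_, hM⟩ := H.bounded
  GapFragmentation.integrableOn_gain i H.continuous hM

theorem tendsto_one (H : IsRelativeProfile i c h) : Tendsto h atTop (𝓝 1) := by
  have h1 : Tendsto (fun y : ℝ => ∫ w in (0 : ℝ)..y, gain i h w) atTop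
      (𝓝 (∫ w in Ioi 0, gain i h w)) :=
    intervalIntegral_tendsto_integral_Ioi 0 H.integrableOn_gain tendsto_id
  have h2 : Tendsto (fun y : ℝ => 1 - c * ((∫ w in Ioi 0, gain i h w) -
      ∫ w in (0 : ℝ)..y, gain i h w)) atTop (𝓝 (1 - c * 0)) := by
    refine tendsto_const_nhds.sub (Tendsto.const_mul _ ?_)
    simpa using (tendsto_const_nhds (x := ∫ w in Ioi 0, gain i h w)).sub h1
  rw [mul_zero, sub_zero] at h2
  refine h2.congr' ?_
  filter_upwards [eventually_ge_atTop 0] with y hy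
  rw [H.eq_one_sub y hy, intervalIntegral.integral_of_le hy, ← Ioc_union_Ioi_eq_Ioi hy,
    setIntegral_union Ioc_disjoint_Ioi_same measurableSet_Ioi
      (H.integrableOn_gain.mono_set Ioc_subset_Ioi_self)
      (H.integrableOn_gain.mono_set (Ioi_subset_Ioi hy))]
  ring

theorem hasDerivAt (H : IsRelativeProfile i c h) {y : ℝ} (hy : 0 < y) :
    HasDerivAt h (c * gain i h y) y := by
  obtain ⟨M, hM⟩ := H.bounded
  have hcont := continuousOn_gain i H.continuous hM
  have hd : HasDerivAt (fun u => ∫ w in (0 : ℝ)..u, gain i h w) (gain i h y) y :=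
    intervalIntegral.integral_hasDerivAt_right
      ((intervalIntegrable_iff_integrableOn_Ioc_of_le hy.le).2
        (H.integrableOn_gain.mono_set Ioc_subset_Ioi_self))
      (hcont.stronglyMeasurableAtFilter isOpen_Ioi y hy)
      (hcont.continuousAt (Ioi_mem_nhds hy))
  have hd2 := ((hd.const_sub (∫ w in Ioi 0, gain i h w)).const_mul c).const_sub 1
  rw [mul_neg, neg_neg] at hd2
  refine hd2.congr_of_eventuallyEq ?_
  filter_upwards [lt_mem_nhds hy] with u hu
  rw [H.eq_one_sub u hu.le, intervalIntegral.integral_of_le hu.le, ← Ioc_union_Ioi_eq_Ioi hu.le,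
    setIntegral_union Ioc_disjoint_Ioi_same measurableSet_Ioi
      (H.integrableOn_gain.mono_set Ioc_subset_Ioi_self)
      (H.integrableOn_gain.mono_set (Ioi_subset_Ioi hu.le))]
  ring

/-- The differentiated function is `y^2 f(y)` with `f = tailWeight i * h`; the result is the profile
equation in its balance form, loss against gain. -/
theorem hasDerivAt_exp_neg_mul (H : IsRelativeProfile i c h) {y : ℝ} (hy : 0 < y) :
    HasDerivAt (fun y => Real.exp (-y ^ (2 * i + 3)) * h y)
      (c * (y ^ (i + 2) * tailMoment i h y) -
        (2 * i + 3) * (y ^ (2 * i + 2) * (Real.exp (-y ^ (2 * i + 3)) * h y))) y := by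
  have h1 := ((hasDerivAt_pow (2 * i + 3) y).neg.exp).mul (H.hasDerivAt hy)
  convert! h1 using 1
  have e : Real.exp (-y ^ (2 * i + 3)) * Real.exp (y ^ (2 * i + 3)) = 1 := by
    rw [← Real.exp_add]; simp
  unfold gain
  simp only [Pi.neg_apply]
  push_cast
  linear_combination (-c * (y ^ (i + 2) * tailMoment i h y)) * e

theorem integrableOn_pow_mul (H : IsRelativeProfile i c h) (n : ℕ) :
    IntegrableOn (fun z => z ^ n * (Real.exp (-z ^ (2 * i + 3)) * h z)) (Ioi 0) := by
  obtain ⟨M, hM⟩ := H.bounded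
  have hc := H.continuous
  refine Integrable.mono' ((integrableOn_pow_mul_exp_neg_mul_pow one_pos n i).mul_const M)
    (Continuous.aestronglyMeasurable (by fun_prop)) ?_
  filter_upwards [ae_restrict_mem measurableSet_Ioi] with z hz
  have hz : 0 < z := hz
  rw [norm_mul, norm_mul, Real.norm_eq_abs, Real.norm_eq_abs, Real.norm_eq_abs, Real.abs_exp,
    abs_of_pos (by positivity), ← mul_assoc, neg_one_mul]
  gcongr
  exact hM z

/-- The hypothesis `hcβ` says that loss equals total gain for each parent `z`. After integration
over `(y,∞)` the daughters wider than `y` cancel, and only those below `y` remain, with a positive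
kernel. -/
theorem flux_identity (H : IsRelativeProfile i c h) {y : ℝ} (hy : 0 < y)
    (hcβ : ∀ z : ℝ, 0 < z → c * ∫ w in (0 : ℝ)..z, w ^ (i + 2) * (z - w) ^ (i + 1) =
      (2 * i + 3) * z ^ (2 * i + 4)) :
    IntegrableOn (fun z => c * smallDaughters i y z * (tailWeight i z * h z)) (Ioi y) ∧
    Real.exp (-y ^ (2 * i + 3)) * h y =
      ∫ z in Ioi y, c * smallDaughters i y z * (tailWeight i z * h z) := by
  obtain ⟨M, hM⟩ := H.bounded
  obtain ⟨I1, I2, hswap⟩ := gain_fubini i H.continuous hy hM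
  have I3 : IntegrableOn (fun z => ((2 * i + 3 : ℝ) *
      (z ^ (2 * i + 2) * (Real.exp (-z ^ (2 * i + 3)) * h z)))) (Ioi y) :=
    ((H.integrableOn_pow_mul (2 * i + 2)).mono_set (Ioi_subset_Ioi hy.le)).const_mul _
  have hlim : Tendsto (fun y => Real.exp (-y ^ (2 * i + 3)) * h y) atTop (𝓝 (0 * 1)) :=
    ((Real.tendsto_exp_neg_atTop_nhds_zero).comp (tendsto_pow_atTop (by omega))).mul H.tendsto_one
  rw [zero_mul] at hlim
  have hF := integral_Ioi_of_hasDerivAt_of_tendsto'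
    (fun x (hx : x ∈ Ici y) => H.hasDerivAt_exp_neg_mul (hy.trans_le hx))
    ((I1.const_mul c).sub I3) hlim
  rw [integral_sub (I1.const_mul c) I3, integral_const_mul, hswap, ← integral_const_mul,
    ← integral_sub (I2.const_mul c) I3, zero_sub] at hF
  have hpt : ∀ z ∈ Ioi y, (2 * i + 3 : ℝ) * (z ^ (2 * i + 2) * (Real.exp (-z ^ (2 * i + 3)) * h z)) -
      c * ((∫ w in y..z, w ^ (i + 2) * (z - w) ^ (i + 1)) * (tailWeight i z * h z)) =
      c * smallDaughters i y z * (tailWeight i z * h z) := by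
    intro z hz
    have hz0 : 0 < z := hy.trans hz
    have hadd := intervalIntegral.integral_add_adjacent_intervals (μ := volume)
      (f := fun w : ℝ => w ^ (i + 2) * (z - w) ^ (i + 1)) (a := 0) (b := y) (c := z)
      (Continuous.intervalIntegrable (by fun_prop) _ _)
      (Continuous.intervalIntegrable (by fun_prop) _ _)
    have hb := hcβ z hz0
    rw [← hadd] at hb
    have e : z ^ (2 * i + 2) * (Real.exp (-z ^ (2 * i + 3)) * h z) =
        z ^ (2 * i + 4) * (tailWeight i z * h z) := by
      unfold tailWeight
      field_simp
      ring
    unfold smallDaughters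
    rw [e]
    linear_combination (-(tailWeight i z * h z)) * hb
  refine ⟨IntegrableOn.congr_fun (I3.sub (I2.const_mul c)) hpt measurableSet_Ioi, ?_⟩
  rw [← setIntegral_congr_fun measurableSet_Ioi hpt]
  rw [← neg_inj, ← hF, ← integral_neg]
  simp only [neg_sub]

end IsRelativeProfile

/-! ### Positivity and behaviour at zero. -/

theorem setIntegral_Ioi_pos {f : ℝ → ℝ} {a : ℝ} (hf : IntegrableOn f (Ioi a))
    (hpos : ∀ x ∈ Ioi a, 0 < f x) : 0 < ∫ x in Ioi a, f x := by
  rw [setIntegral_pos_iff_support_of_nonneg_ae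
    ((ae_restrict_mem measurableSet_Ioi).mono fun x hx => (hpos x hx).le) hf]
  have : Function.support f ∩ Ioi a = Ioi a :=
    inter_eq_right.2 fun x hx => (hpos x hx).ne'
  rw [this]
  simp

theorem smallDaughters_pos (i : ℕ) {y z : ℝ} (hy : 0 < y) (hyz : y ≤ z) :
    0 < smallDaughters i y z := by
  refine intervalIntegral.intervalIntegral_pos_of_pos_on
    (Continuous.intervalIntegrable (by fun_prop) _ _) (fun w hw => ?_) hy
  have := sub_pos.2 (hw.2.trans_le hyz)
  have := hw.1
  positivity

theorem smallDaughters_le (i : ℕ) {y z : ℝ} (hy : 0 < y) (hyz : y ≤ z) :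
    smallDaughters i y z ≤ y ^ (i + 3) * z ^ (i + 1) := by
  have h := intervalIntegral.norm_integral_le_of_norm_le_const (a := 0) (b := y)
    (f := fun w : ℝ => w ^ (i + 2) * (z - w) ^ (i + 1)) (C := y ^ (i + 2) * z ^ (i + 1)) (by
      intro w hw
      rw [uIoc_of_le hy.le] at hw
      have h0 := hw.1
      have h1 := sub_nonneg.2 (hw.2.trans hyz)
      rw [Real.norm_eq_abs, abs_of_nonneg (by positivity)]
      gcongr
      · exact hw.2
      · linarith)
  rw [sub_zero, abs_of_pos hy] at h
  calc smallDaughters i y z ≤ _ := (le_abs_self _).trans h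
    _ = _ := by ring

namespace IsRelativeProfile

variable {i : ℕ} {c : ℝ} {h : ℝ → ℝ}

theorem pos (H : IsRelativeProfile i c h) (hc : 0 < c)
    (hcβ : ∀ z : ℝ, 0 < z → c * ∫ w in (0 : ℝ)..z, w ^ (i + 2) * (z - w) ^ (i + 1) =
      (2 * i + 3) * z ^ (2 * i + 4)) {y : ℝ} (hy : 0 < y) : 0 < h y := by
  by_contra! hneg
  -- This set is closed and, as `h → 1`, bounded. At its supremum the flux identity expresses `h` as
  -- an integral of positive quantities, a contradiction.
  set S : Set ℝ := Ici y ∩ {u | h u ≤ 0} with hS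
  have hSc : IsClosed S := isClosed_Ici.inter (isClosed_le H.continuous continuous_const)
  have hSne : S.Nonempty := ⟨y, self_mem_Ici, hneg⟩
  obtain ⟨Y, hY⟩ := eventually_atTop.1 (H.tendsto_one.eventually_const_lt one_pos)
  have hSb : BddAbove S := ⟨Y, fun u hu => by
    by_contra! hlt
    exact absurd hu.2 (not_le.2 (hY u hlt.le))⟩
  have hmem := hSc.csSup_mem hSne hSb
  set y₀ := sSup S
  have hy₀ : 0 < y₀ := hy.trans_le hmem.1
  have habove : ∀ z ∈ Ioi y₀, 0 < h z := fun z hz => by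
    by_contra! hle
    exact absurd (le_csSup hSb ⟨mem_Ici.2 (le_trans hmem.1 (le_of_lt hz)), hle⟩) (not_le.2 hz)
  obtain ⟨hint, hflux⟩ := H.flux_identity hy₀ hcβ
  have hp : 0 < Real.exp (-y₀ ^ (2 * i + 3)) * h y₀ := by
    rw [hflux]
    refine setIntegral_Ioi_pos hint fun z hz => ?_
    have := smallDaughters_pos i hy₀ (le_of_lt hz)
    have := tailWeight_pos i (hy₀.trans hz)
    have := habove z hz
    positivity
  exact absurd (pos_of_mul_pos_right hp (Real.exp_pos _).le) (not_lt.2 hmem.2)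

theorem integrableOn_pow_mul_tailWeight (H : IsRelativeProfile i c h)
    (hpos : ∀ y, 0 < y → 0 < h y) (n : ℕ) {A : ℝ}
    (hA : ∀ z, 0 < z → z ≤ 1 → z ^ n * (tailWeight i z * h z) ≤ A) :
    IntegrableOn (fun z => z ^ n * (tailWeight i z * h z)) (Ioi 0) := by
  have hmeas : Measurable fun z => z ^ n * (tailWeight i z * h z) := by
    have := measurable_tailWeight i
    have := H.continuous.measurable
    fun_prop
  rw [← Ioc_union_Ioi_eq_Ioi (zero_le_one (α := ℝ))]
  refine IntegrableOn.union ?_ ?_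
  · refine Integrable.mono' (g := fun _ => A) (integrableOn_const (by simp))
      hmeas.aestronglyMeasurable ?_
    filter_upwards [ae_restrict_mem measurableSet_Ioc] with z hz
    have := tailWeight_pos i hz.1
    have := hpos z hz.1
    have := hz.1
    rw [Real.norm_eq_abs, abs_of_pos (by positivity)]
    exact hA z hz.1 hz.2
  · refine Integrable.mono' ((H.integrableOn_pow_mul n).mono_set (Ioi_subset_Ioi zero_le_one))
      hmeas.aestronglyMeasurable ?_
    filter_upwards [ae_restrict_mem measurableSet_Ioi] with z hz
    have hz1 : 1 < z := hz
    have hz0 : 0 < z := one_pos.trans hz1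
    have := tailWeight_pos i hz0
    have := hpos z hz0
    rw [Real.norm_eq_abs, abs_of_pos (by positivity)]
    gcongr
    unfold tailWeight
    exact div_le_self (Real.exp_pos _).le (one_le_pow₀ hz1.le)

/-- Stated with a majorant `f` because it is used twice: with a crude majorant before the moment of
order `i+1` is known to be finite, and then with that moment's integrand itself. -/
theorem tailWeight_mul_le_of_le (H : IsRelativeProfile i c h) (hc : 0 < c)
    (hcβ : ∀ z : ℝ, 0 < z → c * ∫ w in (0 : ℝ)..z, w ^ (i + 2) * (z - w) ^ (i + 1) =
      (2 * i + 3) * z ^ (2 * i + 4)) {y : ℝ} (hy : 0 < y) {f : ℝ → ℝ}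
    (hf : IntegrableOn f (Ioi y)) (hle : ∀ z, y < z → z ^ (i + 1) * (tailWeight i z * h z) ≤ f z) :
    tailWeight i y * h y ≤ c * y ^ (i + 1) * ∫ z in Ioi y, f z := by
  obtain ⟨hint, hflux⟩ := H.flux_identity hy hcβ
  have e : Real.exp (-y ^ (2 * i + 3)) * h y = y ^ 2 * (tailWeight i y * h y) := by
    unfold tailWeight; field_simp
  rw [e] at hflux
  have hmono : y ^ 2 * (tailWeight i y * h y) ≤ ∫ z in Ioi y, c * y ^ (i + 3) * f z := by
    rw [hflux]
    refine setIntegral_mono_on hint (hf.const_mul _) measurableSet_Ioi fun z hz => ?_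
    have hz : y < z := hz
    have h1 := tailWeight_pos i (hy.trans hz)
    have h2 := H.pos hc hcβ (hy.trans hz)
    calc _ ≤ c * (y ^ (i + 3) * z ^ (i + 1)) * (tailWeight i z * h z) := by
          gcongr; exact smallDaughters_le i hy hz.le
      _ = c * y ^ (i + 3) * (z ^ (i + 1) * (tailWeight i z * h z)) := by ring
      _ ≤ _ := by gcongr; exact hle z hz
  rw [integral_const_mul] at hmono
  have hy2 : 0 < y ^ 2 := by positivity
  refine le_of_mul_le_mul_left (hmono.trans_eq ?_) hy2
  ring

theorem exists_tailWeight_mul_le (H : IsRelativeProfile i c h) (hc : 0 < c)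
    (hcβ : ∀ z : ℝ, 0 < z → c * ∫ w in (0 : ℝ)..z, w ^ (i + 2) * (z - w) ^ (i + 1) =
      (2 * i + 3) * z ^ (2 * i + 4)) :
    ∃ A, 0 < A ∧ ∀ y, 0 < y → tailWeight i y * h y ≤ A * y ^ (i + 1) := by
  have hpos : ∀ y, 0 < y → 0 < h y := fun y hy => H.pos hc hcβ hy
  have hφ : ∀ y, 0 < y → 0 < tailWeight i y * h y := fun y hy =>
    mul_pos (tailWeight_pos i hy) (hpos y hy)
  have hJi := H.integrableOn_pow_mul (i + 1)
  set J := ∫ z in Ioi 0, z ^ (i + 1) * (Real.exp (-z ^ (2 * i + 3)) * h z) with hJ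
  -- Replacing `z^(-2)` by `y^(-2)` for `z > y` removes the singularity at zero, at the cost of two
  -- powers of `y`.
  have hcrude : ∀ y, 0 < y → y ^ 2 * (tailWeight i y * h y) ≤ c * y ^ (i + 1) * J := by
    intro y hy
    have h1 := H.tailWeight_mul_le_of_le hc hcβ hy
      (f := fun z => (y ^ 2)⁻¹ * (z ^ (i + 1) * (Real.exp (-z ^ (2 * i + 3)) * h z)))
      ((hJi.mono_set (Ioi_subset_Ioi hy.le)).const_mul _) (fun z hz => by
        have hz0 := hy.trans hz
        have := hpos z hz0
        calc z ^ (i + 1) * (tailWeight i z * h z)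
            = (z ^ 2)⁻¹ * (z ^ (i + 1) * (Real.exp (-z ^ (2 * i + 3)) * h z)) := by
              unfold tailWeight; ring
          _ ≤ _ := by gcongr)
    rw [integral_const_mul] at h1
    have h2 : ∫ z in Ioi y, z ^ (i + 1) * (Real.exp (-z ^ (2 * i + 3)) * h z) ≤ J := by
      refine setIntegral_mono_set hJi ?_ (Ioi_subset_Ioi hy.le).eventuallyLE
      filter_upwards [ae_restrict_mem measurableSet_Ioi] with z hz
      have hz : 0 < z := hz
      have := hpos z hz
      simp only [Pi.zero_apply]
      positivity
    calc _ ≤ y ^ 2 * (c * y ^ (i + 1) * ((y ^ 2)⁻¹ * J)) := by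
          refine mul_le_mul_of_nonneg_left (h1.trans ?_) (by positivity)
          gcongr
      _ = _ := by field_simp
  -- The loss is affordable: the integrand is at most `c J z^(2i)` near zero, because `(i+1) + (i+1)
  -- - 2 = 2i`.
  have hint := H.integrableOn_pow_mul_tailWeight hpos (i + 1) (A := c * J) fun z hz hz1 => by
    have h1 := hcrude z hz
    have h2 : 0 ≤ c * J := by
      have : 0 < c * z ^ (i + 1) * J := lt_of_lt_of_le (mul_pos (by positivity) (hφ z hz)) h1
      have h3 : 0 < z ^ (i + 1) * (c * J) := by linarith
      exact (pos_of_mul_pos_right h3 (by positivity)).le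
    have e : z ^ (i + 1) * (tailWeight i z * h z) =
        z ^ (i + 1) / z ^ 2 * (z ^ 2 * (tailWeight i z * h z)) := by field_simp
    rw [e]
    calc _ ≤ z ^ (i + 1) / z ^ 2 * (c * z ^ (i + 1) * J) := by gcongr
      _ = z ^ (2 * i) * (c * J) := by field_simp; ring
      _ ≤ 1 * (c * J) := by gcongr; exact pow_le_one₀ hz.le hz1
      _ = _ := one_mul _
  have hJ'pos := setIntegral_Ioi_pos hint fun z hz => by
    have hz : 0 < z := hz
    have := hφ z hz
    positivity
  refine ⟨c * ∫ z in Ioi 0, z ^ (i + 1) * (tailWeight i z * h z), by positivity, fun y hy => ?_⟩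
  have h1 := H.tailWeight_mul_le_of_le hc hcβ hy (hint.mono_set (Ioi_subset_Ioi hy.le)) fun z _ => le_rfl
  have h2 : ∫ z in Ioi y, z ^ (i + 1) * (tailWeight i z * h z) ≤
      ∫ z in Ioi 0, z ^ (i + 1) * (tailWeight i z * h z) := by
    refine setIntegral_mono_set hint ?_ (Ioi_subset_Ioi hy.le).eventuallyLE
    filter_upwards [ae_restrict_mem measurableSet_Ioi] with z hz
    have hz : 0 < z := hz
    have := hφ z hz
    simp only [Pi.zero_apply]
    positivity
  calc _ ≤ c * y ^ (i + 1) * ∫ z in Ioi 0, z ^ (i + 1) * (tailWeight i z * h z) :=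
        h1.trans (by gcongr)
    _ = _ := by ring

end IsRelativeProfile

/-! ### Similarity scaling and normalisation. -/

theorem integrableOn_and_integral_comp_mul_left {f : ℝ → ℝ} {q : ℝ} (hq : 0 < q) (a : ℝ)
    (hf : IntegrableOn f (Ioi (q * a))) :
    IntegrableOn (fun x => f (q * x)) (Ioi a) ∧
      ∫ x in Ioi a, f (q * x) = q⁻¹ * ∫ x in Ioi (q * a), f x :=
  ⟨(integrableOn_Ioi_comp_mul_left_iff f a hq).2 hf, integral_comp_mul_left_Ioi f a hq⟩

theorem hasDerivAt_root {b : ℝ} (hb : 0 < b) (n : ℕ) {t : ℝ} (ht : 0 < t) :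
    HasDerivAt (fun s : ℝ => (b * s) ^ (((n + 1 : ℕ) : ℝ)⁻¹))
      (b / ((n + 1) * ((b * t) ^ (((n + 1 : ℕ) : ℝ)⁻¹)) ^ n)) t := by
  have hbt : 0 < b * t := by positivity
  set q := (b * t) ^ (((n + 1 : ℕ) : ℝ)⁻¹) with hq
  have hq0 : 0 < q := Real.rpow_pos_of_pos hbt _
  have hqr : q ^ (n + 1) = b * t := Real.rpow_inv_natCast_pow hbt.le (by omega)
  have h1 := ((hasDerivAt_id' t).const_mul b).rpow_const (p := ((n + 1 : ℕ) : ℝ)⁻¹)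
    (Or.inl hbt.ne')
  convert h1 using 1
  rw [Real.rpow_sub_one hbt.ne', ← hq, ← hqr, pow_succ]
  push_cast
  field_simp

namespace IsRelativeProfile

variable {i : ℕ} {c : ℝ} {h : ℝ → ℝ}

theorem hasDerivAt_similarity (H : IsRelativeProfile i c h) {b x t : ℝ} (hb : 0 < b) (hx : 0 < x)
    (ht : 0 < t) (hcb : c * b = 2 * (2 * i + 3)) {Q : ℝ → ℝ}
    (hQ : Q = fun s : ℝ => (b * s) ^ (((2 * i + 2 + 1 : ℕ) : ℝ)⁻¹)) :
    HasDerivAt (fun s => Q s ^ 2 * (tailWeight i (Q s * x) * h (Q s * x)))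
      (-(b * x ^ (2 * i + 3)) * (Q t ^ 2 * (tailWeight i (Q t * x) * h (Q t * x))) +
        2 * x ^ (i + 1) * Q t ^ 2 * (Q t ^ (i + 2))⁻¹ * tailMoment i h (Q t * x)) t := by
  have hQpos : ∀ s, 0 < s → 0 < Q s := fun s hs => by
    rw [hQ]; exact Real.rpow_pos_of_pos (by positivity) _
  have hQd : HasDerivAt Q (b / (((2 * i + 2 : ℕ) + 1) * Q t ^ (2 * i + 2))) t := by
    rw [hQ]; exact hasDerivAt_root hb (2 * i + 2) ht
  have hq := hQpos t ht
  have hG := (H.hasDerivAt_exp_neg_mul (mul_pos hq hx)).comp t (hQd.mul_const x)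
  have hG2 := hG.const_mul (x ^ 2)⁻¹
  have hfun : (fun s => Q s ^ 2 * (tailWeight i (Q s * x) * h (Q s * x))) =ᶠ[𝓝 t]
      -- Since `Q^2 f(Q x) = x^(-2) (y^2 f)(Q x)`, the chain rule needs only the derivative of `y^2
      -- f`.
      fun s => (x ^ 2)⁻¹ * ((fun y => Real.exp (-y ^ (2 * i + 3)) * h y) ∘ fun s => Q s * x) s := by
    filter_upwards [lt_mem_nhds ht] with s hs
    have := (hQpos s hs).ne'
    simp only [Function.comp_apply, tailWeight]
    field_simp
  refine (hG2.congr_of_eventuallyEq hfun).congr_deriv ?_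
  have hqne := hq.ne'
  have hc' : c = 2 * (2 * i + 3) / b := by rw [← hcb]; field_simp
  set q := Q t
  unfold tailWeight
  set e := Real.exp (-(q * x) ^ (2 * i + 3))
  set T := tailMoment i h (q * x)
  set g := h (q * x)
  rw [hc']
  push_cast
  have h3 : (2 * (i : ℝ) + 2 + 1) ≠ 0 := by positivity
  have h3' : (2 * (i : ℝ) + 3) ≠ 0 := by positivity
  field_simp
  ring

end IsRelativeProfile

theorem exists_isRelativeProfile (i : ℕ) {c : ℝ} (hc : 0 < c) : ∃ h, IsRelativeProfile i c h := by
  obtain ⟨h, h1, h2, h3⟩ := exists_relative_profile i hc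
  exact ⟨h, h1, h2, h3⟩

theorem exists_similarity_profile (i : ℕ) :
    ∃ f : ℝ → ℝ, (∀ y, 0 < y → 0 < f y) ∧ IntegrableOn f (Ioi 0) ∧
      IntegrableOn (fun y => y * f y) (Ioi 0) ∧
      (∃ A, ∀ y, 0 < y → f y ≤ A * y ^ (i + 1)) ∧
      (∃ M, ∀ y, 0 < y → f y ≤ M * (Real.exp (-y ^ (2 * i + 3)) / y ^ 2)) ∧
      ∃ Q : ℝ → ℝ, (∀ t, 0 < t → 0 < Q t) ∧
        IsGapSolution i fun x t => Q t ^ 2 * f (Q t * x) := by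
  set b := ProbabilityTheory.beta ((i : ℝ) + 2) ((i : ℝ) + 2) with hb_def
  have hb : 0 < b := ProbabilityTheory.beta_pos (by positivity) (by positivity)
  -- The same `c` makes the profile equation match the evolution equation and makes the length
  -- balance `hcβ` exact.
  set c : ℝ := 2 * (2 * i + 3) / b with hc_def
  have hc : 0 < c := by positivity
  have hcb : c * b = 2 * (2 * i + 3) := by rw [hc_def]; field_simp
  obtain ⟨h, H⟩ := exists_isRelativeProfile i hc
  have hcβ : ∀ z : ℝ, 0 < z → c * ∫ w in (0 : ℝ)..z, w ^ (i + 2) * (z - w) ^ (i + 1) =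
      (2 * i + 3) * z ^ (2 * i + 4) := fun z hz => by
    have := two_mul_integral_pow_mul_sub_pow i hz
    rw [← hb_def] at this
    linear_combination (c / 2) * this + (z ^ (2 * i + 4) / 2) * hcb
  have hpos : ∀ y, 0 < y → 0 < h y := fun y hy => H.pos hc hcβ hy
  obtain ⟨A, hA0, hA⟩ := H.exists_tailWeight_mul_le hc hcβ
  obtain ⟨M, hM⟩ := H.bounded
  have hA1 : ∀ n : ℕ, ∀ z : ℝ, 0 < z → z ≤ 1 → z ^ n * (tailWeight i z * h z) ≤ A := by
    intro n z hz hz1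
    have := mul_pos (tailWeight_pos i hz) (hpos z hz)
    have h1 : A * z ^ (i + 1) ≤ A := mul_le_of_le_one_right hA0.le (pow_le_one₀ hz.le hz1)
    exact (mul_le_of_le_one_left this.le (pow_le_one₀ hz.le hz1)).trans ((hA z hz).trans h1)
  have hI0 := H.integrableOn_pow_mul_tailWeight hpos 0 (hA1 0)
  have hI1 := H.integrableOn_pow_mul_tailWeight hpos 1 (hA1 1)
  simp only [pow_zero, one_mul] at hI0
  simp only [pow_one] at hI1
  obtain ⟨Q, hQ⟩ : ∃ Q : ℝ → ℝ, Q = fun s => (b * s) ^ (((2 * i + 2 + 1 : ℕ) : ℝ)⁻¹) := ⟨_, rfl⟩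
  have hQpos : ∀ t, 0 < t → 0 < Q t := fun t ht => by
    rw [hQ]; exact Real.rpow_pos_of_pos (by positivity) _
  refine ⟨fun y => tailWeight i y * h y, fun y hy => mul_pos (tailWeight_pos i hy) (hpos y hy),
    hI0, hI1, ⟨A, hA⟩, ⟨M, fun y hy => ?_⟩, Q, hQpos, ?_⟩
  · rw [mul_comm M]
    exact mul_le_mul_of_nonneg_left ((le_abs_self _).trans (hM y)) (tailWeight_pos i hy).le
  · intro t ht x hx
    have hd := H.hasDerivAt_similarity hb hx ht hcb hQ
    have hq : 0 < Q t := hQpos t ht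
    obtain ⟨hint, hval⟩ := integrableOn_and_integral_comp_mul_left hq x
      (integrableOn_tailMoment_integrand i H.continuous (mul_pos hq hx) hM)
    have e : (fun y => daughterKernel i x y * (Q t ^ 2 * (tailWeight i (Q t * y) * h (Q t * y)))) =
        fun y => 2 * x ^ (i + 1) * Q t ^ 2 * (Q t ^ (i + 1))⁻¹ *
          ((Q t * y - Q t * x) ^ (i + 1) * (tailWeight i (Q t * y) * h (Q t * y))) := by
      ext y
      rw [← mul_sub, mul_pow, daughterKernel]
      field_simp
    refine ⟨?_, ?_⟩
    · beta_reduce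
      rw [e]
      exact hint.const_mul _
    · beta_reduce
      rw [e, integral_const_mul, hval]
      refine hd.congr_deriv ?_
      simp only [fragRate, tailMoment, ← hb_def]
      field_simp
      ring

/-- The moments of `Q^2 f(Q x)` are `N = Q m₀` and `V = m₁`; writing `Q x = (m₁/m₀) (N x / V)`
dictates both constants in the rescaled profile. -/
theorem hasSimilarityForm_of_scaling {f : ℝ → ℝ} (hf : IntegrableOn f (Ioi 0))
    (hf1 : IntegrableOn (fun y => y * f y) (Ioi 0)) {m₀ m₁ : ℝ} (hm₀ : 0 < m₀) (hm₁ : 0 < m₁)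
    (h₀ : ∫ y in Ioi 0, f y = m₀) (h₁ : ∫ y in Ioi 0, y * f y = m₁) {Q : ℝ → ℝ}
    (hQ : ∀ t, 0 < t → 0 < Q t) :
    HasSimilarityForm (fun y => m₁ / m₀ ^ 2 * f (m₁ / m₀ * y)) fun x t => Q t ^ 2 * f (Q t * x) := by
  refine ⟨m₁, hm₁, fun t ht => ?_⟩
  have hq := hQ t ht
  obtain ⟨hi0, hv0⟩ := integrableOn_and_integral_comp_mul_left (f := f) hq 0 (by simpa using hf)
  obtain ⟨hi1, hv1⟩ := integrableOn_and_integral_comp_mul_left (f := fun y => y * f y) hq 0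
    (by simpa using hf1)
  rw [mul_zero, h₀] at hv0
  rw [mul_zero, h₁] at hv1
  have e1 : (fun x => x * (Q t ^ 2 * f (Q t * x))) = fun x => Q t * (Q t * x * f (Q t * x)) := by
    ext x; ring
  have hz : zerothMoment (fun x t => Q t ^ 2 * f (Q t * x)) t = Q t * m₀ := by
    rw [zerothMoment, integral_const_mul, hv0]; field_simp
  refine ⟨hi0.const_mul _, ?_, ?_, ?_, fun x hx => ?_⟩
  · rw [e1]; exact hi1.const_mul _
  · rw [hz]; positivity
  · rw [firstMoment, e1, integral_const_mul, hv1]; field_simp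
  · beta_reduce
    rw [hz, show m₁ / m₀ * (Q t * m₀ * x / m₁) = Q t * x by field_simp]
    field_simp

theorem isReducedDistribution_scaling {f : ℝ → ℝ} (hpos : ∀ y, 0 < y → 0 < f y)
    (hf : IntegrableOn f (Ioi 0))
    (hf1 : IntegrableOn (fun y => y * f y) (Ioi 0)) {m₀ m₁ : ℝ} (hm₀ : 0 < m₀) (hm₁ : 0 < m₁)
    (h₀ : ∫ y in Ioi 0, f y = m₀) (h₁ : ∫ y in Ioi 0, y * f y = m₁) :
    IsReducedDistribution fun y => m₁ / m₀ ^ 2 * f (m₁ / m₀ * y) := by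
  have hL : 0 < m₁ / m₀ := by positivity
  obtain ⟨hi0, hv0⟩ := integrableOn_and_integral_comp_mul_left (f := f) hL 0 (by simpa using hf)
  obtain ⟨hi1, hv1⟩ := integrableOn_and_integral_comp_mul_left (f := fun y => y * f y) hL 0
    (by simpa using hf1)
  rw [mul_zero, h₀] at hv0
  rw [mul_zero, h₁] at hv1
  have e1 : (fun y => y * (m₁ / m₀ ^ 2 * f (m₁ / m₀ * y))) =
      fun y => m₀⁻¹ * (m₁ / m₀ * y * f (m₁ / m₀ * y)) := by
    ext x; field_simp
  refine ⟨fun y hy => ?_, hi0.const_mul _, ?_, ?_, ?_⟩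
  · have := hpos _ (mul_pos hL hy)
    positivity
  · rw [e1]; exact hi1.const_mul _
  · rw [integral_const_mul, hv0]; field_simp
  · rw [e1, integral_const_mul, hv1]; field_simp

end GapFragmentation

theorem theorem1 (i : ℕ) :
    ∃ φ : ℝ → ℝ,
      GapFragmentation.IsReducedDistribution φ ∧
      (∃ n : ℝ → ℝ → ℝ,
        GapFragmentation.IsGapSolution i n ∧ GapFragmentation.HasSimilarityForm φ n) ∧
      φ =O[𝓝[>] (0 : ℝ)] (fun y : ℝ => y ^ (i + 1)) ∧
      ∃ c : ℝ, 0 < c ∧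
        φ =O[atTop] (fun y : ℝ => y ^ (-2 : ℤ) * Real.exp (-c * y ^ (2 * i + 3))) := by
  obtain ⟨f, hpos, hf, hf1, ⟨A, hA⟩, ⟨M, hM⟩, Q, hQ, hsol⟩ :=
    GapFragmentation.exists_similarity_profile i
  have hm₀ : 0 < ∫ y in Ioi 0, f y := GapFragmentation.setIntegral_Ioi_pos hf hpos
  have hm₁ : 0 < ∫ y in Ioi 0, y * f y := GapFragmentation.setIntegral_Ioi_pos hf1
    fun y hy => mul_pos hy (hpos y hy)
  set m₀ := ∫ y in Ioi 0, f y with h₀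
  set m₁ := ∫ y in Ioi 0, y * f y with h₁
  have hL : 0 < m₁ / m₀ := by positivity
  have hpos' : ∀ y, 0 < y → 0 < m₁ / m₀ ^ 2 * f (m₁ / m₀ * y) := fun y hy =>
    mul_pos (by positivity) (hpos _ (mul_pos hL hy))
  refine ⟨fun y => m₁ / m₀ ^ 2 * f (m₁ / m₀ * y),
    GapFragmentation.isReducedDistribution_scaling hpos hf hf1 hm₀ hm₁ h₀.symm h₁.symm,
    ⟨_, hsol, GapFragmentation.hasSimilarityForm_of_scaling hf hf1 hm₀ hm₁ h₀.symm h₁.symm hQ⟩,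
    -- The unit rate in `exp(-y^(2i+3))` becomes this constant under the dilation by `m₁/m₀`.
    ?_, (m₁ / m₀) ^ (2 * i + 3), by positivity, ?_⟩
  · refine IsBigO.of_bound (m₁ / m₀ ^ 2 * (A * (m₁ / m₀) ^ (i + 1))) ?_
    filter_upwards [self_mem_nhdsWithin] with y hy
    have hy : 0 < y := hy
    rw [Real.norm_eq_abs, Real.norm_eq_abs, abs_of_pos (hpos' y hy), abs_of_pos (by positivity)]
    calc _ ≤ m₁ / m₀ ^ 2 * (A * (m₁ / m₀ * y) ^ (i + 1)) := by
          gcongr; exact hA _ (mul_pos hL hy)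
      _ = _ := by rw [mul_pow]; ring
  · refine IsBigO.of_bound (m₁ / m₀ ^ 2 * (M * ((m₁ / m₀) ^ 2)⁻¹)) ?_
    filter_upwards [eventually_gt_atTop 0] with y hy
    rw [Real.norm_eq_abs, Real.norm_eq_abs, abs_of_pos (hpos' y hy), abs_of_pos (by positivity)]
    calc _ ≤ m₁ / m₀ ^ 2 * (M * (Real.exp (-(m₁ / m₀ * y) ^ (2 * i + 3)) / (m₁ / m₀ * y) ^ 2)) := by
          gcongr; exact hM _ (mul_pos hL hy)
      _ = _ := by
        rw [mul_pow, mul_pow, neg_mul, zpow_neg, show (2 : ℤ) = ((2 : ℕ) : ℤ) from rfl,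
          zpow_natCast, div_eq_mul_inv _ (_ * y ^ 2), mul_inv]
        ring
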